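/- Let $\Omega\subset\mathbb{R}^d$ be a non-empty compact convex set with (Euclidean) diameter $D$, let $L>0$, and let $f=\frac1n\sum_{i=1}^n f_i$, where each $f_i:\mathbb{R}^d\to\mathbb{R}$ is differentiable, convex and $L$-smooth, that is, $\nabla f_i(v)^\top(w-v)\le f_i(w)-f_i(v)\le\nabla f_i(v)^\top(w-v)+\frac L2\|w-v\|^2$ for all $w,v\in\mathbb{R}^d$. Let $w^*\in\arg\min_{w\in\Omega}f(w)$ be any minimizer. For $w,w_0\in\Omega$, a sample of the variance-reduced stochastic gradient $\tilde\nabla f(w;w_0)$ is $\nabla f_i(w)-(\nabla f_i(w_0)-\nabla f(w_0))$ with $i$ uniform on $\{1,\dots,n\}$. The algorithm STORC with parameters $\gamma_k,\beta_k,\eta_{t,k},m_{t,k},N_t$ is the following. Take an arbitrary $x\in\Omega$ and $w_0\in\arg\min_{w\in\Omega}\nabla f(x)^\top w$. For $t=1,2,\dots$: set $x_0=y_0=w_{t-1}$; for $k=1,\dots,N_t$ let 1. $z_k=(1-\gamma_k)y_{k-1}+\gamma_k x_{k-1}$; 2. $\tilde\nabla_k$ be the average of $m_{t,k}$ fresh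 i.i.d. samples of $\tilde\nabla f(z_k;y_0)$; 3. $x_k\in\Omega$ be the output of the Frank-Wolfe algorithm for $\min_{x\in\Omega}g(x)$, $g(x)=\frac{\beta_k}2\|x-x_{k-1}\|^2+\tilde\nabla_k^\top x$, run until the duality gap satisfies $\max_{x\in\Omega}\nabla g(x_k)^\top(x_k-x)\le\eta_{t,k}$ (starting point in $\Omega$, step sizes in $[0,1]$ and tie-breaking are arbitrary, and the output is determined by $t,k,x_{k-1},\tilde\nabla_k$); 4. $y_k=(1-\gamma_k)y_{k-1}+\gamma_k x_k$; and then set $w_t=y_{N_t}$. Let $$\gamma_k=\frac{2}{k+1},\qquad \beta_k=\frac{3L}{k},\qquad \eta_{t,k}=\frac{2LD_t^2}{N_tk}.$$ Then $\mathbb{E}[f(w_t)-f(w^*)]\le\frac{LD^2}{2^{t+1}}$ for every $t\ge0$ in each of the following three cases: (a) $\nabla f(w^*)=0$, with $D_t=D$, $N_t=\lceil 2^{t/2+2}\rceil$, $m_{t,k}=900N_t$; (b) $f$ is $G$-Lipschitz on $\Omega$, i.e. $\|\nabla f(w)\|\le G$ for all $w\in\Omega$, with $D_t=D$, $N_t=\lceil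 2^{t/2+2}\rceil$, $m_{t,k}=\left\lceil 700N_t+\frac{24N_tG(k+1)}{LD}\right\rceil$ (if $D=0$ the fraction is read as $0$); (c) $f$ is $\alpha$-strongly convex on $\Omega$ with $\alpha>0$, i.e. $f(w)-f(v)\le\nabla f(w)^\top(w-v)-\frac\alpha2\|w-v\|^2$ for all $w,v\in\Omega$, with $\mu=L/\alpha$, $D_t^2=\frac{\mu D^2}{2^{t-1}}$, $N_t=\lceil\sqrt{32\mu}\,\rceil$, $m_{t,k}=\lceil 5600N_t\mu\rceil$. -/

import Mathlib

noncomputable section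

namespace STORC

open MeasureTheory ProbabilityTheory

/-- The Euclidean space `ℝ^d`. -/
abbrev Vec (d : ℕ) : Type := EuclideanSpace ℝ (Fin d)

/-- `h` is differentiable, convex and `L`-smooth on all of `ℝ^d`. -/
structure IsConvexSmooth {d : ℕ} (L : ℝ) (h : Vec d → ℝ) : Prop where
  differentiable : Differentiable ℝ h
  lower : ∀ w v : Vec d, inner ℝ (gradient h v) (w - v) ≤ h w - h v
  upper : ∀ w v : Vec d,
    h w - h v ≤ inner ℝ (gradient h v) (w - v) + L / 2 * ‖w - v‖ ^ 2

/-- `h` is `G`-Lipschitz on `K`: its gradient is bounded by `G` there. -/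
def IsGLipschitz {d : ℕ} (K : Set (Vec d)) (G : ℝ) (h : Vec d → ℝ) : Prop :=
  ∀ w ∈ K, ‖gradient h w‖ ≤ G

/-- `h` is `α`-strongly convex on `K`. -/
def IsStronglyConvex {d : ℕ} (K : Set (Vec d)) (α : ℝ) (h : Vec d → ℝ) : Prop :=
  ∀ w ∈ K, ∀ v ∈ K,
    h w - h v ≤ inner ℝ (gradient h w) (w - v) - α / 2 * ‖w - v‖ ^ 2

/-- The objective `f = (1/n) ∑ i, f_i`. -/
def objective {d n : ℕ} (F : Fin n → Vec d → ℝ) (w : Vec d) : ℝ :=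
  (1 / (n : ℝ)) * ∑ i, F i w

/-- `v` is a minimizer over `K` of the linear function `u ↦ ⟨c, u⟩`. -/
def IsLinearArgmin {d : ℕ} (K : Set (Vec d)) (c v : Vec d) : Prop :=
  v ∈ K ∧ ∀ u ∈ K, inner ℝ c v ≤ inner ℝ c u

/-- The duality gap `max_{u ∈ K} ⟨∇h(x), x - u⟩` of `h` at `x` is at most `η`. -/
def DualityGapLE {d : ℕ} (K : Set (Vec d)) (h : Vec d → ℝ) (η : ℝ) (x : Vec d) : Prop :=
  ∀ u ∈ K, inner ℝ (gradient h x) (x - u) ≤ η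

/-- `x` is the output of a run of Frank-Wolfe for `min_{u ∈ K} h u`, stopped as soon as the duality
gap is at most `η`. The starting point in `K`, the step sizes in `[0, 1]` and the choice among
several minimizers of the linear subproblem are arbitrary. -/
def IsFrankWolfeOutput {d : ℕ} (K : Set (Vec d)) (h : Vec d → ℝ) (η : ℝ) (x : Vec d) : Prop :=
  ∃ (u v : ℕ → Vec d) (ρ : ℕ → ℝ) (J : ℕ),
    u 0 ∈ K ∧
    (∀ j < J, ¬ DualityGapLE K h η (u j) ∧
      IsLinearArgmin K (gradient h (u j)) (v j) ∧
      ρ j ∈ Set.Icc (0 : ℝ) 1 ∧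
      u (j + 1) = (1 - ρ j) • u j + ρ j • v j) ∧
    DualityGapLE K h η (u J) ∧
    x = u J

/-- The variance-reduced stochastic gradient at `w` with snapshot `w₀` and sampled index `i`. -/
def vrGrad {d n : ℕ} (F : Fin n → Vec d → ℝ) (w w₀ : Vec d) (i : Fin n) : Vec d :=
  gradient (F i) w - (gradient (F i) w₀ - gradient (objective F) w₀)

/-- The average of `m` variance-reduced stochastic gradients, with sampled indices
`idx 0, …, idx (m - 1)`. -/
def batchGrad {d n : ℕ} (F : Fin n → Vec d → ℝ) (m : ℕ) (w w₀ : Vec d) (idx : ℕ → Fin n) : Vec d :=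
  (1 / (m : ℝ)) • ∑ j ∈ Finset.range m, vrGrad F w w₀ (idx j)

/-- The objective `g(x) = (β/2) ‖x - x'‖² + ⟨c, x⟩` of the inner problem. -/
def subproblem {d : ℕ} (β : ℝ) (x' c : Vec d) (x : Vec d) : ℝ :=
  β / 2 * ‖x - x'‖ ^ 2 + inner ℝ c x

/-- The parameters of the algorithm; `t` and `k` count from `1`. -/
structure Params where
  γ : ℕ → ℝ
  β : ℕ → ℝ
  η : ℕ → ℕ → ℝ
  m : ℕ → ℕ → ℕ
  N : ℕ → ℕ

/-- `solver t k x' c` is what the inner Frank-Wolfe routine returns in outer iteration `t` and inner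
iteration `k`, when called with previous point `x'` and gradient estimate `c`. -/
def IsFrankWolfeSolver {d : ℕ} (K : Set (Vec d)) (p : Params)
    (solver : ℕ → ℕ → Vec d → Vec d → Vec d) : Prop :=
  ∀ t k : ℕ, 1 ≤ t → 1 ≤ k → k ≤ p.N t → ∀ x' ∈ K, ∀ c : Vec d,
    IsFrankWolfeOutput K (subproblem (p.β k) x' c) (p.η t k) (solver t k x' c)

/-- The pair `(x_k, y_k)` of inner iteration `k` of outer iteration `t`, started at the snapshot
`y₀`; `idx k j` is the `j`-th index sampled in inner iteration `k`. -/
def innerLoop {d n : ℕ} (F : Fin n → Vec d → ℝ) (p : Params)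
    (solver : ℕ → ℕ → Vec d → Vec d → Vec d) (t : ℕ) (y₀ : Vec d) (idx : ℕ → ℕ → Fin n) :
    ℕ → Vec d × Vec d
  | 0 => (y₀, y₀)
  | k + 1 =>
    let x' := (innerLoop F p solver t y₀ idx k).1
    let y' := (innerLoop F p solver t y₀ idx k).2
    let z := (1 - p.γ (k + 1)) • y' + p.γ (k + 1) • x'
    let x := solver t (k + 1) x' (batchGrad F (p.m t (k + 1)) z y₀ (idx (k + 1)))
    (x, (1 - p.γ (k + 1)) • y' + p.γ (k + 1) • x)

/-- The iterate `w_t` of the algorithm started at `w₀`; `idx t k j` is the `j`-th index sampled in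
inner iteration `k` of outer iteration `t`. -/
def iterate {d n : ℕ} (F : Fin n → Vec d → ℝ) (p : Params)
    (solver : ℕ → ℕ → Vec d → Vec d → Vec d) (w₀ : Vec d) (idx : ℕ → ℕ → ℕ → Fin n) : ℕ → Vec d
  | 0 => w₀
  | t + 1 =>
    (innerLoop F p solver (t + 1) (iterate F p solver w₀ idx t) (idx (t + 1)) (p.N (t + 1))).2

/-- The random indices `idx t k j` are independent and uniformly distributed on the `n` indices. -/
structure IsIIDUniform {S : Type*} [MeasurableSpace S] (P : Measure S) {n : ℕ}
    (idx : ℕ → ℕ → ℕ → S → Fin n) : Prop where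
  measurable : ∀ t k j, Measurable (idx t k j)
  indep : iIndepFun (fun s : ℕ × ℕ × ℕ => idx s.1 s.2.1 s.2.2) P
  uniform : ∀ t k j, ∀ i : Fin n, P {ω | idx t k j ω = i} = (n : ENNReal)⁻¹

/-- The parameters `γ_k = 2/(k+1)`, `β_k = 3L/k`, `η_{t,k} = 2 L D_t² / (N_t k)`. -/
def params (L : ℝ) (Dt : ℕ → ℝ) (N : ℕ → ℕ) (m : ℕ → ℕ → ℕ) : Params where
  γ k := 2 / ((k : ℝ) + 1)
  β k := 3 * L / (k : ℝ)
  η t k := 2 * L * Dt t ^ 2 / ((N t : ℝ) * (k : ℝ))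
  m := m
  N := N

end STORC

end

/-! Within an epoch, the potential `k (k + 1) (f(y_k) - f(w*)) + 3 L ‖x_k - w*‖²` of accelerated
gradient descent grows at each step only by the tolerance of the inner solver and by the error of
the gradient estimate. The variance of a sample is bounded by passing from `∇f_i(z_{k+1})` to
`∇f_i(y_0)` through `∇f_i(y_k)` and `∇f_i(w*)`: smoothness bounds the first difference by the
distance of `z_{k+1}` to `y_k`, and co-coercivity with the optimality of `w*` over the convex set
bounds the other two by optimality gaps at feasible points. Batches of `700 N` samples then cost at
most `L D_t² / N` per step, an epoch of `N` steps ends with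
`N (N + 1) 𝔼[f(y_N) - f(w*)] ≤ 8 L D_t²`, and `N` is chosen so that this halves the gap.

Only finitely many sampled indices determine `w_t`, so its expectation is an average over all their
values; independence enters as the invariance of this average under resampling one index. -/

noncomputable section

namespace STORC

open MeasureTheory ProbabilityTheory
open scoped BigOperators

theorem norm_add_sub_sq_le {E : Type*} [SeminormedAddCommGroup E] (u v w : E) :
    ‖u + v - w‖ ^ 2 ≤ 3 * (‖u‖ ^ 2 + ‖v‖ ^ 2 + ‖w‖ ^ 2) := by
  have h : ‖u + v - w‖ ≤ ‖u‖ + ‖v‖ + ‖w‖ :=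
    (norm_sub_le _ _).trans (by gcongr; exact norm_add_le _ _)
  nlinarith [pow_le_pow_left₀ (norm_nonneg _) h 2, sq_nonneg (‖u‖ - ‖v‖), sq_nonneg (‖u‖ - ‖w‖),
    sq_nonneg (‖v‖ - ‖w‖)]

theorem norm_combination_sub_sq_le {E : Type*} [SeminormedAddCommGroup E] [NormedSpace ℝ E]
    {γ : ℝ} (hγ : γ ∈ Set.Icc (0 : ℝ) 1) (x y w : E) :
    ‖(1 - γ) • y + γ • x - w‖ ^ 2 ≤ (1 - γ) * ‖y - w‖ ^ 2 + γ * ‖x - w‖ ^ 2 := by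
  have h := ((convexOn_univ_dist w).pow (fun _ _ => dist_nonneg) 2).2 (Set.mem_univ y)
    (Set.mem_univ x) (sub_nonneg.2 hγ.2) hγ.1 (sub_add_cancel 1 γ)
  simpa [dist_eq_norm] using h

section InnerProductSpace

variable {ι E : Type*} [NormedAddCommGroup E] [InnerProductSpace ℝ E]

theorem inner_expect_left [Fintype ι] [Module ℚ≥0 E] (v : ι → E) (u : E) :
    inner ℝ (𝔼 i, v i) u = 𝔼 i, inner ℝ (v i) u := by
  simp only [Finset.expect, ← sum_inner]
  exact map_nnrat_smul ((innerₗ E).flip u) _ _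

theorem neg_inner_le {σ : ℝ} (hσ : 0 < σ) (u v : E) :
    -inner ℝ u v ≤ ‖u‖ ^ 2 / (2 * σ) + σ / 2 * ‖v‖ ^ 2 := by
  have hsq : 0 ≤ ‖u + σ • v‖ ^ 2 / (2 * σ) := by positivity
  rw [norm_add_sq_real, inner_smul_right, norm_smul, mul_pow, Real.norm_eq_abs, sq_abs] at hsq
  have : (‖u‖ ^ 2 + 2 * (σ * inner ℝ u v) + σ ^ 2 * ‖v‖ ^ 2) / (2 * σ) =
      ‖u‖ ^ 2 / (2 * σ) + inner ℝ u v + σ / 2 * ‖v‖ ^ 2 := by field_simp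
  linarith

theorem expect_norm_sub_expect_sq_le [Fintype ι] [Module ℚ≥0 E] (v : ι → E) :
    𝔼 i, ‖v i - 𝔼 j, v j‖ ^ 2 ≤ 𝔼 i, ‖v i‖ ^ 2 := by
  rcases isEmpty_or_nonempty ι with _ | _
  · simp
  have h : 𝔼 i, ‖v i - 𝔼 j, v j‖ ^ 2 = 𝔼 i, ‖v i‖ ^ 2 - ‖𝔼 j, v j‖ ^ 2 := by
    simp only [norm_sub_sq_real, Finset.expect_add_distrib, Finset.expect_sub_distrib,
      ← Finset.mul_expect, ← inner_expect_left, real_inner_self_eq_norm_sq, Fintype.expect_const]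
    ring
  rw [h]
  exact sub_le_self _ (sq_nonneg _)

theorem inner_gradient_nonneg_of_isMinOn [CompleteSpace E] {K : Set E} (hK : Convex ℝ K)
    {h : E → ℝ} {w u : E} (hh : DifferentiableAt ℝ h w) (hmin : IsMinOn h K w) (hw : w ∈ K)
    (hu : u ∈ K) : 0 ≤ inner ℝ (gradient h w) (u - w) := by
  simpa [gradient] using hmin.localize.hasFDerivWithinAt_nonneg hh.hasFDerivAt.hasFDerivWithinAt
    (sub_mem_posTangentConeAt_of_segment_subset (hK.segment_subset hw hu))

end InnerProductSpace

section Smoothness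

variable {d : ℕ} {L : ℝ} {K : Set (Vec d)}

theorem IsConvexSmooth.norm_gradient_sub_sq_le {h : Vec d → ℝ} (hL : 0 < L)
    (hh : IsConvexSmooth L h) (u v : Vec d) :
    ‖gradient h u - gradient h v‖ ^ 2 ≤
      2 * L * (h u - h v - inner ℝ (gradient h v) (u - v)) := by
  set g := gradient h u - gradient h v with hg
  -- Compare the two bounds at the endpoint of a gradient step from `u` for `h - ⟪∇h(v), ·⟫`.
  have lower := hh.lower (u - L⁻¹ • g) v
  have upper := hh.upper (u - L⁻¹ • g) u
  have hself : inner ℝ (gradient h u) g - inner ℝ (gradient h v) g = ‖g‖ ^ 2 := by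
    rw [← inner_sub_left, ← hg, real_inner_self_eq_norm_sq]
  rw [sub_right_comm, inner_sub_right, inner_smul_right] at lower
  rw [sub_sub_cancel_left, inner_neg_right, inner_smul_right, norm_neg, norm_smul, mul_pow,
    Real.norm_eq_abs, sq_abs] at upper
  have hmul : ‖g‖ ^ 2 = 2 * L * (L⁻¹ * ‖g‖ ^ 2 - L / 2 * (L⁻¹ ^ 2 * ‖g‖ ^ 2)) := by
    field_simp
    ring
  rw [hmul]
  refine mul_le_mul_of_nonneg_left ?_ (by positivity)
  linear_combination lower + upper - L⁻¹ * hself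

theorem IsConvexSmooth.norm_gradient_sub_sq_le_norm_sub_sq {h : Vec d → ℝ} (hL : 0 < L)
    (hh : IsConvexSmooth L h) (u v : Vec d) :
    ‖gradient h u - gradient h v‖ ^ 2 ≤ L ^ 2 * ‖u - v‖ ^ 2 :=
  calc ‖gradient h u - gradient h v‖ ^ 2
      ≤ 2 * L * (h u - h v - inner ℝ (gradient h v) (u - v)) := hh.norm_gradient_sub_sq_le hL u v
    _ ≤ 2 * L * (L / 2 * ‖u - v‖ ^ 2) := by gcongr; linarith [hh.upper u v]
    _ = L ^ 2 * ‖u - v‖ ^ 2 := by ring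

theorem IsLinearArgmin.sub_le {f : Vec d → ℝ} (hf : IsConvexSmooth L f) {x v w : Vec d}
    (hw : w ∈ K) (hv : IsLinearArgmin K (gradient f x) v) :
    f v - f w ≤ L / 2 * ‖v - x‖ ^ 2 := by
  have upper := hf.upper v x
  have lower := hf.lower w x
  have hmin := hv.2 w hw
  rw [inner_sub_right] at upper lower
  linarith

theorem IsLinearArgmin.sub_le_diam {f : Vec d → ℝ} (hf : IsConvexSmooth L f) (hL : 0 ≤ L)
    (hK : Bornology.IsBounded K) {x v w : Vec d} (hx : x ∈ K) (hw : w ∈ K)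
    (hv : IsLinearArgmin K (gradient f x) v) : f v - f w ≤ L * Metric.diam K ^ 2 / 2 := by
  have hdist : ‖v - x‖ ≤ Metric.diam K := by
    rw [← dist_eq_norm]
    exact Metric.dist_le_diam_of_mem hK hv.1 hx
  calc f v - f w ≤ L / 2 * ‖v - x‖ ^ 2 := sub_le hf hw hv
    _ ≤ L / 2 * Metric.diam K ^ 2 := by gcongr
    _ = L * Metric.diam K ^ 2 / 2 := by ring

theorem IsStronglyConvex.norm_sub_sq_le (hK : Convex ℝ K) {f : Vec d → ℝ} {α : ℝ}
    (hα : IsStronglyConvex K α f) {w u : Vec d} (hf : DifferentiableAt ℝ f w)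
    (hmin : IsMinOn f K w) (hw : w ∈ K) (hu : u ∈ K) : α / 2 * ‖u - w‖ ^ 2 ≤ f u - f w := by
  have hsc := hα w hw u hu
  have hopt := inner_gradient_nonneg_of_isMinOn hK hf hmin hw hu
  rw [← neg_sub u w, inner_neg_right, norm_neg] at hsc
  linarith

theorem IsStronglyConvex.le_of_nontrivial {f : Vec d → ℝ} {α : ℝ} (hα : IsStronglyConvex K α f)
    (hf : IsConvexSmooth L f) (hK : K.Nontrivial) : α ≤ L := by
  obtain ⟨w, hw, u, hu, hne⟩ := hK
  have hsc := hα w hw u hu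
  have upper := hf.upper u w
  rw [← neg_sub u w, inner_neg_right, norm_neg] at hsc
  have hpos : 0 < ‖u - w‖ ^ 2 := by
    have := norm_pos_iff.2 (sub_ne_zero.2 hne.symm)
    positivity
  exact le_of_mul_le_mul_right (by linarith) hpos

end Smoothness

section Objective

variable {d n : ℕ} {L : ℝ} {F : Fin n → Vec d → ℝ}

theorem objective_eq_expect (F : Fin n → Vec d → ℝ) (w : Vec d) :
    objective F w = 𝔼 i, F i w := by
  rw [objective, Fintype.expect_eq_sum_div_card, Fintype.card_fin, one_div_mul_eq_div]

theorem gradient_objective (hF : ∀ i, Differentiable ℝ (F i)) (w : Vec d) :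
    gradient (objective F) w = 𝔼 i, gradient (F i) w := by
  apply HasGradientAt.gradient
  rw [hasGradientAt_iff_hasFDerivAt]
  have hsum := (HasFDerivAt.fun_sum fun i (_ : i ∈ Finset.univ) =>
    (hF i w).hasFDerivAt).const_mul (1 / (n : ℝ))
  refine hsum.congr_fderiv ?_
  ext u
  simp [gradient, inner_expect_left, Fintype.expect_eq_sum_div_card, inv_mul_eq_div]

theorem inner_gradient_objective (hF : ∀ i, Differentiable ℝ (F i)) (v u : Vec d) :
    inner ℝ (gradient (objective F) v) u = 𝔼 i, inner ℝ (gradient (F i) v) u := by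
  rw [gradient_objective hF, inner_expect_left]

theorem objective_sub_objective (F : Fin n → Vec d → ℝ) (w v : Vec d) :
    objective F w - objective F v = 𝔼 i, (F i w - F i v) := by
  rw [objective_eq_expect, objective_eq_expect, Finset.expect_sub_distrib]

theorem isConvexSmooth_objective [NeZero n] (hF : ∀ i, IsConvexSmooth L (F i)) :
    IsConvexSmooth L (objective F) where
  differentiable := by
    have := fun i => (hF i).differentiable
    unfold objective
    fun_prop
  lower w v := by
    rw [inner_gradient_objective fun i => (hF i).differentiable, objective_sub_objective]
    exact Finset.expect_le_expect fun i _ => (hF i).lower w v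
  upper w v := by
    rw [inner_gradient_objective fun i => (hF i).differentiable, objective_sub_objective,
      ← Fintype.expect_const (ι := Fin n) (L / 2 * ‖w - v‖ ^ 2), ← Finset.expect_add_distrib]
    exact Finset.expect_le_expect fun i _ => (hF i).upper w v

theorem expect_vrGrad_sub (hF : ∀ i, Differentiable ℝ (F i)) [NeZero n] (z y : Vec d) :
    𝔼 i, (vrGrad F z y i - gradient (objective F) z) = 0 := by
  simp only [vrGrad, Finset.expect_sub_distrib, Fintype.expect_const, ← gradient_objective hF]
  abel

theorem expect_norm_vrGrad_sub_sq_le (hF : ∀ i, Differentiable ℝ (F i)) (z y : Vec d) :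
    𝔼 i, ‖vrGrad F z y i - gradient (objective F) z‖ ^ 2 ≤
      𝔼 i, ‖gradient (F i) z - gradient (F i) y‖ ^ 2 := by
  have hcentered : ∀ i, vrGrad F z y i - gradient (objective F) z =
      gradient (F i) z - gradient (F i) y - 𝔼 j, (gradient (F j) z - gradient (F j) y) := by
    intro i
    rw [Finset.expect_sub_distrib, ← gradient_objective hF, ← gradient_objective hF, vrGrad]
    abel
  simp only [hcentered]
  exact expect_norm_sub_expect_sq_le _

end Objective

section Minimization

variable {d n : ℕ} {K : Set (Vec d)} {L : ℝ} {F : Fin n → Vec d → ℝ} {wstar u : Vec d}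

/-- The finite-sum problem `min_{w ∈ K} (1/n) ∑ i, f_i w` over a convex set with convex `L`-smooth
components, together with one of its solutions `wstar`. -/
structure IsFiniteSumMin (K : Set (Vec d)) (L : ℝ) (F : Fin n → Vec d → ℝ) (wstar : Vec d) :
    Prop where
  convex : Convex ℝ K
  pos : 0 < L
  convexSmooth : ∀ i, IsConvexSmooth L (F i)
  mem : wstar ∈ K
  isMinOn : IsMinOn (objective F) K wstar

/-- The optimality gap `f(u) - f(w*)`. -/
def optGap (F : Fin n → Vec d → ℝ) (wstar u : Vec d) : ℝ :=
  objective F u - objective F wstar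

theorem IsFiniteSumMin.optGap_nonneg (h : IsFiniteSumMin K L F wstar) (hu : u ∈ K) :
    0 ≤ optGap F wstar u :=
  sub_nonneg.2 (h.isMinOn hu)

theorem IsFiniteSumMin.expect_norm_gradient_sub_sq_le [NeZero n]
    (h : IsFiniteSumMin K L F wstar) (hu : u ∈ K) :
    𝔼 i, ‖gradient (F i) u - gradient (F i) wstar‖ ^ 2 ≤ 2 * L * optGap F wstar u := by
  have hopt := inner_gradient_nonneg_of_isMinOn h.convex
    ((isConvexSmooth_objective h.convexSmooth).differentiable wstar) h.isMinOn h.mem hu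
  calc 𝔼 i, ‖gradient (F i) u - gradient (F i) wstar‖ ^ 2
      ≤ 𝔼 i, 2 * L * (F i u - F i wstar - inner ℝ (gradient (F i) wstar) (u - wstar)) :=
        Finset.expect_le_expect fun i _ => (h.convexSmooth i).norm_gradient_sub_sq_le h.pos u wstar
    _ = 2 * L * (optGap F wstar u - inner ℝ (gradient (objective F) wstar) (u - wstar)) := by
        rw [← Finset.mul_expect, Finset.expect_sub_distrib, optGap, objective_sub_objective,
          inner_gradient_objective fun i => (h.convexSmooth i).differentiable]
    _ ≤ 2 * L * optGap F wstar u :=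
        mul_le_mul_of_nonneg_left (sub_le_self _ hopt) (mul_nonneg zero_le_two h.pos.le)

-- In the algorithm `z` is close to a `y` whose expected optimality gap is already under control.
theorem IsFiniteSumMin.expect_norm_vrGrad_sub_sq_le [NeZero n] (h : IsFiniteSumMin K L F wstar)
    {y y₀ : Vec d} (hy : y ∈ K) (hy₀ : y₀ ∈ K) (z : Vec d) :
    𝔼 i, ‖vrGrad F z y₀ i - gradient (objective F) z‖ ^ 2 ≤
      3 * (L ^ 2 * ‖z - y‖ ^ 2 + 2 * L * optGap F wstar y + 2 * L * optGap F wstar y₀) := by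
  have hsplit : ∀ i, ‖gradient (F i) z - gradient (F i) y₀‖ ^ 2 ≤
      3 * (L ^ 2 * ‖z - y‖ ^ 2 + ‖gradient (F i) y - gradient (F i) wstar‖ ^ 2 +
        ‖gradient (F i) y₀ - gradient (F i) wstar‖ ^ 2) := fun i => by
    have htri := norm_add_sub_sq_le (gradient (F i) z - gradient (F i) y)
      (gradient (F i) y - gradient (F i) wstar) (gradient (F i) y₀ - gradient (F i) wstar)
    rw [sub_add_sub_cancel, sub_sub_sub_cancel_right] at htri
    linarith [(h.convexSmooth i).norm_gradient_sub_sq_le_norm_sub_sq h.pos z y]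
  calc 𝔼 i, ‖vrGrad F z y₀ i - gradient (objective F) z‖ ^ 2
      ≤ 𝔼 i, ‖gradient (F i) z - gradient (F i) y₀‖ ^ 2 :=
        STORC.expect_norm_vrGrad_sub_sq_le (fun i => (h.convexSmooth i).differentiable) z y₀
    _ ≤ 𝔼 i, 3 * (L ^ 2 * ‖z - y‖ ^ 2 + ‖gradient (F i) y - gradient (F i) wstar‖ ^ 2 +
          ‖gradient (F i) y₀ - gradient (F i) wstar‖ ^ 2) :=
        Finset.expect_le_expect fun i _ => hsplit i
    _ ≤ 3 * (L ^ 2 * ‖z - y‖ ^ 2 + 2 * L * optGap F wstar y + 2 * L * optGap F wstar y₀) := by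
        rw [← Finset.mul_expect, Finset.expect_add_distrib, Finset.expect_add_distrib,
          Fintype.expect_const]
        gcongr
        exacts [h.expect_norm_gradient_sub_sq_le hy, h.expect_norm_gradient_sub_sq_le hy₀]

end Minimization

section AcceleratedStep

variable {d : ℕ} {L : ℝ} {K : Set (Vec d)} {f : Vec d → ℝ} {w x' y' z c x : Vec d}

theorem two_div_add_two_mem_Icc (k : ℕ) : 2 / (k + 2 : ℝ) ∈ Set.Icc (0 : ℝ) 1 :=
  ⟨by positivity, div_le_one_of_le₀ (by linarith [k.cast_nonneg (α := ℝ)]) (by positivity)⟩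

theorem gradient_subproblem (β : ℝ) (x' c x : Vec d) :
    gradient (subproblem β x' c) x = β • (x - x') + c := by
  apply HasGradientAt.gradient
  rw [hasGradientAt_iff_hasFDerivAt]
  have hsq := (((hasFDerivAt_id x).sub_const x').norm_sq).const_mul (β / 2)
  refine (hsq.add (innerSL ℝ c).hasFDerivAt).congr_fderiv ?_
  ext y
  simp
  ring

theorem DualityGapLE.inner_sub_le {β η : ℝ} (hx : DualityGapLE K (subproblem β x' c) η x)
    (hw : w ∈ K) :
    inner ℝ c (x - w) ≤ η + β / 2 * (‖x' - w‖ ^ 2 - ‖x - w‖ ^ 2 - ‖x - x'‖ ^ 2) := by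
  have hgap := hx w hw
  have hthree := norm_sub_sq_real (x - w) (x - x')
  rw [sub_sub_sub_cancel_left, real_inner_comm] at hthree
  rw [gradient_subproblem, inner_add_left, real_inner_smul_left] at hgap
  rw [hthree]
  linarith

theorem IsConvexSmooth.combination_sub_le (hf : IsConvexSmooth L f) {γ : ℝ}
    (hγ : γ ∈ Set.Icc (0 : ℝ) 1) (hz : z = (1 - γ) • y' + γ • x') (w x : Vec d) :
    f ((1 - γ) • y' + γ • x) - f w ≤ (1 - γ) * (f y' - f w) +
      γ * (inner ℝ (gradient f z) (x - w) + L * γ / 2 * ‖x - x'‖ ^ 2) := by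
  have upper := hf.upper ((1 - γ) • y' + γ • x) z
  have lower_y' := mul_le_mul_of_nonneg_left (hf.lower y' z) (sub_nonneg.2 hγ.2)
  have lower_w := mul_le_mul_of_nonneg_left (hf.lower w z) hγ.1
  have hdist : ‖(1 - γ) • y' + γ • x - z‖ ^ 2 = γ ^ 2 * ‖x - x'‖ ^ 2 := by
    rw [hz, add_sub_add_left_eq_sub, ← smul_sub, norm_smul, mul_pow, Real.norm_eq_abs, sq_abs]
  have hinner : inner ℝ (gradient f z) ((1 - γ) • y' + γ • x - z) =
      (1 - γ) * inner ℝ (gradient f z) (y' - z) + γ * inner ℝ (gradient f z) (w - z) +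
        γ * inner ℝ (gradient f z) (x - w) := by
    simp only [← inner_smul_right, ← inner_add_right]
    congr 1
    module
  rw [hdist, hinner] at upper
  linarith

theorem IsConvexSmooth.accelerated_step (hf : IsConvexSmooth L f) {γ β σ η : ℝ}
    (hγ : γ ∈ Set.Icc (0 : ℝ) 1) (hσ : 0 < σ) (hβ : L * γ + σ ≤ β)
    (hz : z = (1 - γ) • y' + γ • x') (hx : DualityGapLE K (subproblem β x' c) η x) (hw : w ∈ K) :
    f ((1 - γ) • y' + γ • x) - f w ≤ (1 - γ) * (f y' - f w) +
      γ * (η + β / 2 * (‖x' - w‖ ^ 2 - ‖x - w‖ ^ 2) + ‖c - gradient f z‖ ^ 2 / (2 * σ) -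
        inner ℝ (c - gradient f z) (x' - w)) := by
  have coupling := hf.combination_sub_le hγ hz w x
  have hprox := hx.inner_sub_le hw
  have young := neg_inner_le hσ (c - gradient f z) (x - x')
  have hsplit : inner ℝ (gradient f z) (x - w) = inner ℝ c (x - w) -
      inner ℝ (c - gradient f z) (x - x') - inner ℝ (c - gradient f z) (x' - w) := by
    rw [sub_sub, ← inner_add_right, sub_add_sub_cancel, inner_sub_left, sub_sub_cancel]
  have hcoef := mul_le_mul_of_nonneg_right hβ (sq_nonneg ‖x - x'‖)
  refine coupling.trans (add_le_add_right (mul_le_mul_of_nonneg_left ?_ hγ.1) _)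
  rw [hsplit]
  linarith

-- The weights `(k + 1)(k + 2)` and `3 L` make the sum telescope; Young's inequality is applied with
-- `σ = L / (k + 1)`, which is at least half of the slack `β - L γ`.
theorem IsConvexSmooth.accelerated_potential_le (hf : IsConvexSmooth L f) (hL : 0 < L) {k : ℕ}
    {η : ℝ} (hz : z = (1 - 2 / (k + 2 : ℝ)) • y' + (2 / (k + 2 : ℝ)) • x')
    (hx : DualityGapLE K (subproblem (3 * L / (k + 1)) x' c) η x) (hw : w ∈ K) :
    (k + 1) * (k + 2) * (f ((1 - 2 / (k + 2 : ℝ)) • y' + (2 / (k + 2 : ℝ)) • x) - f w) +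
        3 * L * ‖x - w‖ ^ 2 ≤
      k * (k + 1) * (f y' - f w) + 3 * L * ‖x' - w‖ ^ 2 + 2 * (k + 1) * η +
        (k + 1) ^ 2 / L * ‖c - gradient f z‖ ^ 2 -
        2 * (k + 1) * inner ℝ (c - gradient f z) (x' - w) := by
  have hβ : L * (2 / (k + 2)) + L / (k + 1) ≤ 3 * L / (k + 1) := by
    have : 3 * L / (k + 1) - (L * (2 / (k + 2)) + L / (k + 1)) = 2 * L / ((k + 1) * (k + 2)) := by
      field_simp
      ring
    have : 0 ≤ 2 * L / ((k + 1) * (k + 2)) := by positivity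
    linarith
  have hstep := mul_le_mul_of_nonneg_left
    (hf.accelerated_step (two_div_add_two_mem_Icc k) (div_pos hL k.cast_add_one_pos) hβ hz hx hw)
    (by positivity : 0 ≤ (k + 1 : ℝ) * (k + 2))
  refine (add_le_add_left hstep _).trans_eq ?_
  field_simp
  ring

end AcceleratedStep

section Resampling

variable {Ω ι α : Type*} [Fintype Ω] [DecidableEq ι] [Fintype α] {X : Ω → ι → α} {J B : Finset ι}
  {s : ι}

/-- Averages over `ω` are unchanged when a coordinate `s ∈ J` of the configuration `X ω` is replaced
by a fresh uniform one. It says that, for uniform `ω`, the coordinates in `J` are i.i.d. uniform and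
independent of the remaining ones. -/
def IsResampleInvariant (X : Ω → ι → α) (J : Finset ι) : Prop :=
  ∀ s ∈ J, ∀ g : (ι → α) → ℝ, 𝔼 ω, g (X ω) = 𝔼 ω, 𝔼 i, g (Function.update (X ω) s i)

theorem isResampleInvariant_updateFinset (b : ι → α) (J : Finset ι) :
    IsResampleInvariant (fun a : J → α => Function.updateFinset b J a) J := by
  classical
  intro s hs g
  rcases isEmpty_or_nonempty α with _ | _
  · have : IsEmpty (J → α) := ⟨fun a => isEmptyElim (a ⟨s, hs⟩)⟩
    simp
  set h : (J → α) → ℝ := fun a => g (Function.updateFinset b J a) with hh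
  have hupdate : ∀ a i, g (Function.update (Function.updateFinset b J a) s i) =
      h (Function.update a ⟨s, hs⟩ i) := by
    intro a i
    rw [hh]
    congr 1
    ext r
    by_cases hr : r = s
    · subst hr
      simp [Function.updateFinset, hs]
    · by_cases hrJ : r ∈ J <;> simp [Function.updateFinset, hr, hrJ]
  let swap : (J → α) × α → (J → α) × α := fun q => (Function.update q.1 ⟨s, hs⟩ q.2, q.1 ⟨s, hs⟩)
  have hswap : Function.Involutive swap := fun q => by simp [swap]
  simp only [hupdate]
  calc 𝔼 a, h a = 𝔼 a, 𝔼 _i : α, h a := by simp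
    _ = 𝔼 q : (J → α) × α, h q.1 := by
        rw [← Finset.univ_product_univ, Finset.expect_product]
    _ = 𝔼 q : (J → α) × α, h (swap q).1 :=
        (Fintype.expect_equiv hswap.toPerm _ _ fun _ => rfl).symm
    _ = 𝔼 a, 𝔼 i, h (Function.update a ⟨s, hs⟩ i) := by
        rw [← Finset.univ_product_univ, Finset.expect_product]

theorem IsResampleInvariant.expect_eq (hX : IsResampleInvariant X J) (hs : s ∈ J)
    {g : (ι → α) → α → ℝ} (hg : DependsOn g {s}ᶜ) :
    𝔼 ω, g (X ω) (X ω s) = 𝔼 ω, 𝔼 i, g (X ω) i := by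
  have hupdate : ∀ a i, g (Function.update a s i) = g a := fun a i =>
    hg fun r hr => Function.update_of_ne hr i a
  simpa [hupdate] using hX s hs fun a => g a (a s)

variable {E : Type*} [NormedAddCommGroup E] [InnerProductSpace ℝ E] {ψ : (ι → α) → α → E}
  {c : (ι → α) → E}

theorem IsResampleInvariant.expect_inner_eq_zero [Module ℚ≥0 E] (hX : IsResampleInvariant X J)
    (hs : s ∈ J) (hψ : DependsOn ψ {s}ᶜ) (hc : DependsOn c {s}ᶜ) (hmean : ∀ a, 𝔼 i, ψ a i = 0) :
    𝔼 ω, inner ℝ (ψ (X ω) (X ω s)) (c (X ω)) = 0 := by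
  rw [hX.expect_eq hs (g := fun a i => inner ℝ (ψ a i) (c a))]
  · simp [← inner_expect_left, hmean]
  · intro a b hab
    simp only [hψ hab, hc hab]

theorem IsResampleInvariant.expect_inner_sum_eq_zero [Module ℚ≥0 E]
    (hX : IsResampleInvariant X J) (hB : B ⊆ J) (hψ : DependsOn ψ (B : Set ι)ᶜ)
    (hc : DependsOn c (B : Set ι)ᶜ) (hmean : ∀ a, 𝔼 i, ψ a i = 0) :
    𝔼 ω, inner ℝ (∑ s ∈ B, ψ (X ω) (X ω s)) (c (X ω)) = 0 := by
  simp only [sum_inner]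
  rw [Finset.expect_sum_comm]
  refine Finset.sum_eq_zero fun s hs => ?_
  have hsub : (B : Set ι)ᶜ ⊆ {s}ᶜ := by simpa using hs
  exact hX.expect_inner_eq_zero (hB hs) (hψ.mono hsub) (hc.mono hsub) hmean

theorem IsResampleInvariant.expect_norm_sum_sq [Module ℚ≥0 E] (hX : IsResampleInvariant X J)
    (hB : B ⊆ J) (hψ : DependsOn ψ (B : Set ι)ᶜ) (hmean : ∀ a, 𝔼 i, ψ a i = 0) :
    𝔼 ω, ‖∑ s ∈ B, ψ (X ω) (X ω s)‖ ^ 2 = B.card * 𝔼 ω, 𝔼 i, ‖ψ (X ω) i‖ ^ 2 := by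
  induction B using Finset.induction_on with
  | empty => simp
  | insert s B hsB ih =>
    rw [Finset.insert_subset_iff] at hB
    rw [Finset.coe_insert] at hψ
    have hψs : DependsOn ψ {s}ᶜ := hψ.mono (by simp)
    have hψB : DependsOn ψ (B : Set ι)ᶜ :=
      hψ.mono (Set.compl_subset_compl.2 (Set.subset_insert _ _))
    have hrest : DependsOn (fun a => ∑ r ∈ B, ψ a (a r)) {s}ᶜ := fun a b hab =>
      Finset.sum_congr rfl fun r hr => by rw [hψs hab, hab r fun h => hsB (h ▸ hr)]
    have hcross := hX.expect_inner_eq_zero hB.1 hψs hrest hmean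
    have hfresh := hX.expect_eq hB.1 (g := fun a i => ‖ψ a i‖ ^ 2) fun a b hab => by
      simp only [hψs hab]
    simp only [Finset.sum_insert hsB, norm_add_sq_real, Finset.expect_add_distrib,
      ← Finset.mul_expect, Finset.card_insert_of_notMem hsB]
    rw [hcross, hfresh, ih hB.2 hψB]
    push_cast
    ring

end Resampling

section Sampling

variable {ι S : Type*} [DecidableEq ι] [MeasurableSpace S] {P : Measure S} [IsProbabilityMeasure P]
  {n : ℕ} {X : ι → S → Fin n}

theorem measureReal_map_restrict_singleton (hX : ∀ s, Measurable (X s)) (hind : iIndepFun X P)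
    (hunif : ∀ s i, P {ω | X s ω = i} = (n : ENNReal)⁻¹) (J : Finset ι) (a : J → Fin n) :
    (P.map fun ω (s : J) => X s ω).real {a} = ((Fintype.card (J → Fin n) : ℕ) : ℝ)⁻¹ := by
  have hJ : iIndepFun (fun s : J => X s) P := hind.precomp Subtype.val_injective
  have hmass : ∀ s : J, P.map (X s) {a s} = (n : ENNReal)⁻¹ := fun s => by
    rw [Measure.map_apply (hX s) (measurableSet_singleton _)]
    exact hunif s (a s)
  have : ∀ s : J, IsProbabilityMeasure (P.map (X s)) := fun s =>
    Measure.isProbabilityMeasure_map (hX s).aemeasurable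
  rw [measureReal_def, (iIndepFun_iff_map_fun_eq_pi_map fun s : J => (hX s).aemeasurable).1 hJ,
    Measure.pi_singleton]
  simp [hmass]

theorem integrable_and_integral_eq_expect (hX : ∀ s, Measurable (X s)) (hind : iIndepFun X P)
    (hunif : ∀ s i, P {ω | X s ω = i} = (n : ENNReal)⁻¹) (b : ι → Fin n) {J : Finset ι}
    {Z : (ι → Fin n) → ℝ} (hZ : DependsOn Z (J : Set ι)) :
    Integrable (fun ω => Z fun s => X s ω) P ∧
      ∫ ω, Z (fun s => X s ω) ∂P = 𝔼 a : J → Fin n, Z (Function.updateFinset b J a) := by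
  set R : S → J → Fin n := fun ω s => X s ω with hR
  have hRm : Measurable R := measurable_pi_lambda _ fun s => hX s
  have : IsProbabilityMeasure (P.map R) := Measure.isProbabilityMeasure_map hRm.aemeasurable
  set h : (J → Fin n) → ℝ := fun a => Z (Function.updateFinset b J a)
  have hfactor : (fun ω => Z fun s => X s ω) = h ∘ R := by
    ext ω
    refine hZ fun s hs => ?_
    simp [R, Function.updateFinset, Finset.mem_coe.1 hs]
  have hint : Integrable h (P.map R) := Integrable.of_finite
  rw [hfactor]
  refine ⟨hint.comp_measurable hRm, ?_⟩
  calc ∫ ω, (h ∘ R) ω ∂P = ∫ a, h a ∂(P.map R) :=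
        (integral_map hRm.aemeasurable hint.aestronglyMeasurable).symm
    _ = ∑ a, (P.map R).real {a} • h a := integral_fintype hint
    _ = 𝔼 a, h a := by
        simp only [hR, measureReal_map_restrict_singleton hX hind hunif, smul_eq_mul,
          ← Finset.mul_sum]
        rw [Fintype.expect_eq_sum_div_card, inv_mul_eq_div]

end Sampling

theorem IsFrankWolfeOutput.mem {d : ℕ} {K : Set (Vec d)} (hK : Convex ℝ K) {h : Vec d → ℝ}
    {η : ℝ} {x : Vec d} (hx : IsFrankWolfeOutput K h η x) : x ∈ K := by
  obtain ⟨u, v, ρ, J, hstart, hstep, -, rfl⟩ := hx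
  have hmem : ∀ j ≤ J, u j ∈ K := by
    intro j
    induction j with
    | zero => exact fun _ => hstart
    | succ j ih =>
      intro hj
      obtain ⟨-, hv, hρ, hnext⟩ := hstep j hj
      rw [hnext]
      exact hK (ih (by omega)) hv.1 (sub_nonneg.2 hρ.2) hρ.1 (sub_add_cancel 1 _)
  exact hmem J le_rfl

/-- The only property of the inner solver that matters: it returns feasible points whose duality
gap is within the prescribed tolerance. -/
def IsApproxSolver {d : ℕ} (K : Set (Vec d)) (p : Params)
    (solver : ℕ → ℕ → Vec d → Vec d → Vec d) : Prop :=
  ∀ t k : ℕ, 1 ≤ t → 1 ≤ k → k ≤ p.N t → ∀ x' ∈ K, ∀ c : Vec d,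
    solver t k x' c ∈ K ∧ DualityGapLE K (subproblem (p.β k) x' c) (p.η t k) (solver t k x' c)

theorem IsFrankWolfeSolver.isApproxSolver {d : ℕ} {K : Set (Vec d)} (hK : Convex ℝ K) {p : Params}
    {solver : ℕ → ℕ → Vec d → Vec d → Vec d} (h : IsFrankWolfeSolver K p solver) :
    IsApproxSolver K p solver := by
  intro t k ht hk hkN x' hx' c
  have hout := h t k ht hk hkN x' hx' c
  refine ⟨hout.mem hK, ?_⟩
  obtain ⟨u, v, ρ, J, -, -, hgap, heq⟩ := hout
  rwa [heq]

/-- The data that determine the points computed by STORC as functions of the sampled indices. -/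
structure Run (d n : ℕ) where
  F : Fin n → Vec d → ℝ
  L : ℝ
  Dt : ℕ → ℝ
  N : ℕ → ℕ
  m : ℕ → ℕ → ℕ
  solver : ℕ → ℕ → Vec d → Vec d → Vec d
  w₀ : Vec d

namespace Run

variable {d n : ℕ} (A : Run d n) (t k : ℕ) (a : ℕ × ℕ × ℕ → Fin n)

/-- The parameters of the run. -/
def toParams : Params :=
  params A.L A.Dt A.N A.m

/-- The iterate `w_t` when the sampled indices are `a`. -/
def w : Vec d :=
  iterate A.F A.toParams A.solver A.w₀ (fun t k j => a (t, k, j)) t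

/-- The pair `(x_k, y_k)` in the epoch that produces `w_{t+1}`: epochs are counted from `0` here. -/
def state : Vec d × Vec d :=
  innerLoop A.F A.toParams A.solver (t + 1) (A.w t a) (fun k j => a (t + 1, k, j)) k

/-- The point `x_k` of the epoch starting at `w_t`. -/
def x : Vec d :=
  (A.state t k a).1

/-- The point `y_k` of the epoch starting at `w_t`. -/
def y : Vec d :=
  (A.state t k a).2

/-- The point `z_{k+1}` of the epoch starting at `w_t`, where the gradient is estimated in order to
pass from step `k` to step `k + 1`. -/
def z : Vec d :=
  (1 - 2 / (k + 2 : ℝ)) • A.y t k a + (2 / (k + 2 : ℝ)) • A.x t k a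

/-- The gradient estimate at `z_{k+1}` in the epoch starting at `w_t`. -/
def gradEstimate : Vec d :=
  batchGrad A.F (A.m (t + 1) (k + 1)) (A.z t k a) (A.w t a) (fun j => a (t + 1, k + 1, j))

/-- The error of the gradient estimate at `z_{k+1}` in the epoch starting at `w_t`. -/
def gradError : Vec d :=
  A.gradEstimate t k a - gradient (objective A.F) (A.z t k a)

theorem toParams_γ_succ : A.toParams.γ (k + 1) = 2 / (k + 2) := by
  simp only [toParams, params]
  push_cast
  ring

theorem toParams_β_succ : A.toParams.β (k + 1) = 3 * A.L / (k + 1) := by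
  simp only [toParams, params]
  push_cast
  rfl

theorem w_succ : A.w (t + 1) a = A.y t (A.N (t + 1)) a := rfl

theorem x_succ :
    A.x t (k + 1) a = A.solver (t + 1) (k + 1) (A.x t k a) (A.gradEstimate t k a) := by
  rw [gradEstimate, z, ← toParams_γ_succ]
  rfl

theorem y_succ : A.y t (k + 1) a =
    (1 - 2 / (k + 2 : ℝ)) • A.y t k a + (2 / (k + 2 : ℝ)) • A.x t (k + 1) a := by
  rw [← toParams_γ_succ]
  rfl

section Dependence

/-- The positions of the indices sampled in the step from `k` to `k + 1` of the epoch starting at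
`w_t`. -/
def batch : Finset (ℕ × ℕ × ℕ) :=
  {t + 1} ×ˢ {k + 1} ×ˢ Finset.range (A.m (t + 1) (k + 1))

/-- The positions of the indices sampled before step `k + 1` of the epoch starting at `w_t`. -/
def history : Finset (ℕ × ℕ × ℕ) :=
  ((Finset.range t).biUnion fun t' => (Finset.range (A.N (t' + 1))).biUnion (A.batch t')) ∪
    (Finset.range k).biUnion (A.batch t)

theorem card_batch : (A.batch t k).card = A.m (t + 1) (k + 1) := by
  simp [batch]

theorem history_succ_right : A.history t (k + 1) = A.history t k ∪ A.batch t k := by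
  simp only [history, Finset.range_add_one, Finset.biUnion_insert]
  rw [Finset.union_assoc, Finset.union_comm (A.batch t k)]

theorem history_succ_zero : A.history (t + 1) 0 = A.history t (A.N (t + 1)) := by
  simp only [history, Finset.range_add_one, Finset.biUnion_insert, Finset.range_zero,
    Finset.biUnion_empty, Finset.union_empty]
  rw [Finset.union_comm]

theorem disjoint_history_batch : Disjoint (A.history t k) (A.batch t k) := by
  simp only [history, batch, Finset.disjoint_left, Finset.mem_union, Finset.mem_biUnion,
    Finset.mem_product, Finset.mem_singleton, Finset.mem_range]
  rintro s (⟨t', ht', -, -, hs, -⟩ | ⟨k', hk', -, hs, -⟩) ⟨hst, hsk, -⟩ <;> omega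

theorem batch_subset_history {T : ℕ} {t k : ℕ} (ht : t < T) (hk : k < A.N (t + 1)) :
    A.batch t k ⊆ A.history T 0 := fun _ hs =>
  Finset.mem_union_left _ <| Finset.mem_biUnion.2
    ⟨t, Finset.mem_range.2 ht, Finset.mem_biUnion.2 ⟨k, Finset.mem_range.2 hk, hs⟩⟩

variable {A t k}

theorem history_zero_subset : A.history t 0 ⊆ A.history t k :=
  Finset.union_subset_union_right (by simp)

theorem dependsOn_state_of_dependsOn_w (h : DependsOn (A.w t) (A.history t 0 : Set (ℕ × ℕ × ℕ))) :
    DependsOn (A.state t k) (A.history t k : Set (ℕ × ℕ × ℕ)) := by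
  induction k with
  | zero =>
    intro a b hab
    simp only [state, innerLoop, h hab]
  | succ k ih =>
    intro a b hab
    have hw : A.w t a = A.w t b := h fun s hs => hab s (history_zero_subset hs)
    have hstate : A.state t k a = A.state t k b :=
      ih fun s hs => hab s (by rw [history_succ_right]; exact Finset.mem_union_left _ hs)
    have hbatch : ∀ j ∈ Finset.range (A.m (t + 1) (k + 1)),
        a (t + 1, k + 1, j) = b (t + 1, k + 1, j) := fun j hj => by
      refine hab _ ?_
      rw [history_succ_right]
      exact Finset.mem_union_right _ (by simpa [batch] using hj)
    have hx : A.x t (k + 1) a = A.x t (k + 1) b := by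
      rw [x_succ, x_succ, gradEstimate, gradEstimate, batchGrad, batchGrad,
        Finset.sum_congr rfl fun j hj => by rw [hbatch j hj]]
      simp only [z, x, y, hstate, hw]
    refine Prod.ext hx ?_
    change A.y t (k + 1) a = A.y t (k + 1) b
    rw [y_succ, y_succ, hx, y, y, hstate]

theorem dependsOn_w : DependsOn (A.w t) (A.history t 0 : Set (ℕ × ℕ × ℕ)) := by
  induction t with
  | zero => exact fun a b _ => rfl
  | succ t ih =>
    intro a b hab
    rw [history_succ_zero] at hab
    rw [w_succ, w_succ, y, y, dependsOn_state_of_dependsOn_w ih hab]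

theorem dependsOn_state : DependsOn (A.state t k) (A.batch t k : Set (ℕ × ℕ × ℕ))ᶜ :=
  (dependsOn_state_of_dependsOn_w dependsOn_w).mono <|
    Set.subset_compl_iff_disjoint_right.2 <| Finset.disjoint_coe.2 <| A.disjoint_history_batch t k

theorem dependsOn_w_compl_batch : DependsOn (A.w t) (A.batch t k : Set (ℕ × ℕ × ℕ))ᶜ :=
  dependsOn_w.mono <| (Finset.coe_subset.2 history_zero_subset).trans <|
    Set.subset_compl_iff_disjoint_right.2 <| Finset.disjoint_coe.2 <| A.disjoint_history_batch t k

end Dependence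

/-- The run solves the problem `min_{w ∈ K} (1/n) ∑ i, f_i w` with solution `wstar`, from a feasible
starting point and with a sufficiently accurate inner solver. -/
structure IsAdmissible (A : Run d n) (K : Set (Vec d)) (wstar : Vec d) : Prop
    extends IsFiniteSumMin K A.L A.F wstar where
  start_mem : A.w₀ ∈ K
  isApproxSolver : IsApproxSolver K A.toParams A.solver

section Feasibility

variable {A t k a} {K : Set (Vec d)} {wstar : Vec d}

theorem IsAdmissible.x_mem_and_y_mem_of_w_mem (h : A.IsAdmissible K wstar) (hw : A.w t a ∈ K)
    (hk : k ≤ A.N (t + 1)) : A.x t k a ∈ K ∧ A.y t k a ∈ K := by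
  induction k with
  | zero => exact ⟨hw, hw⟩
  | succ k ih =>
    obtain ⟨hx, hy⟩ := ih (by omega)
    have hx' : A.x t (k + 1) a ∈ K := by
      rw [x_succ]
      exact (h.isApproxSolver (t + 1) (k + 1) (by omega) (by omega) hk _ hx _).1
    have hγ := two_div_add_two_mem_Icc k
    refine ⟨hx', ?_⟩
    rw [y_succ]
    exact h.convex hy hx' (sub_nonneg.2 hγ.2) hγ.1 (sub_add_cancel 1 _)

theorem IsAdmissible.w_mem (h : A.IsAdmissible K wstar) : A.w t a ∈ K := by
  induction t with
  | zero => exact h.start_mem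
  | succ t ih =>
    rw [w_succ]
    exact (h.x_mem_and_y_mem_of_w_mem ih le_rfl).2

theorem IsAdmissible.x_mem (h : A.IsAdmissible K wstar) (hk : k ≤ A.N (t + 1)) : A.x t k a ∈ K :=
  (h.x_mem_and_y_mem_of_w_mem h.w_mem hk).1

theorem IsAdmissible.y_mem (h : A.IsAdmissible K wstar) (hk : k ≤ A.N (t + 1)) : A.y t k a ∈ K :=
  (h.x_mem_and_y_mem_of_w_mem h.w_mem hk).2

theorem IsAdmissible.potential_step [NeZero n] (h : A.IsAdmissible K wstar)
    (hk : k < A.N (t + 1)) :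
    (k + 1) * (k + 2) * optGap A.F wstar (A.y t (k + 1) a) +
        3 * A.L * ‖A.x t (k + 1) a - wstar‖ ^ 2 ≤
      k * (k + 1) * optGap A.F wstar (A.y t k a) + 3 * A.L * ‖A.x t k a - wstar‖ ^ 2 +
        4 * (A.L * A.Dt (t + 1) ^ 2 / A.N (t + 1)) +
        (k + 1) ^ 2 / A.L * ‖A.gradError t k a‖ ^ 2 -
        2 * (k + 1) * inner ℝ (A.gradError t k a) (A.x t k a - wstar) := by
  have hgap := (h.isApproxSolver (t + 1) (k + 1) (by omega) (by omega) hk (A.x t k a)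
    (h.x_mem hk.le) (A.gradEstimate t k a)).2
  rw [toParams_β_succ, ← x_succ] at hgap
  have hstep := (isConvexSmooth_objective h.convexSmooth).accelerated_potential_le h.pos
    (y' := A.y t k a) (z := A.z t k a) rfl hgap h.mem
  rw [← y_succ] at hstep
  have hη : 2 * (k + 1) * A.toParams.η (t + 1) (k + 1) =
      4 * (A.L * A.Dt (t + 1) ^ 2 / A.N (t + 1)) := by
    simp only [toParams, params]
    push_cast
    field_simp
    ring
  rw [hη] at hstep
  exact hstep

theorem norm_y_succ_sub_sq_le (wstar : Vec d) : ‖A.y t (k + 1) a - wstar‖ ^ 2 ≤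
    (1 - 2 / (k + 2 : ℝ)) * ‖A.y t k a - wstar‖ ^ 2 +
      2 / (k + 2 : ℝ) * ‖A.x t (k + 1) a - wstar‖ ^ 2 := by
  rw [y_succ]
  exact norm_combination_sub_sq_le (two_div_add_two_mem_Icc k) _ _ _

theorem norm_z_sub_y_sq_le (wstar : Vec d) : ‖A.z t k a - A.y t k a‖ ^ 2 ≤
    (2 / (k + 2 : ℝ)) ^ 2 * (2 * ‖A.x t k a - wstar‖ ^ 2 + 2 * ‖A.y t k a - wstar‖ ^ 2) := by
  have hsub : A.z t k a - A.y t k a =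
      (2 / (k + 2 : ℝ)) • ((A.x t k a - wstar) - (A.y t k a - wstar)) := by
    rw [z]
    module
  rw [hsub, norm_smul, mul_pow, Real.norm_eq_abs, sq_abs]
  refine mul_le_mul_of_nonneg_left ?_ (sq_nonneg _)
  have hpar := parallelogram_law_with_norm ℝ (A.x t k a - wstar) (A.y t k a - wstar)
  linarith [mul_self_nonneg ‖A.x t k a - wstar + (A.y t k a - wstar)‖,
    sq ‖A.x t k a - wstar - (A.y t k a - wstar)‖, sq ‖A.x t k a - wstar‖, sq ‖A.y t k a - wstar‖]

end Feasibility

section GradientError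

/-- The error of a single variance-reduced sample with index `i` at `z_{k+1}`, as a function of all
sampled indices `a`. -/
def noise (i : Fin n) : Vec d :=
  vrGrad A.F (A.z t k a) (A.w t a) i - gradient (objective A.F) (A.z t k a)

variable {A t k} {K : Set (Vec d)} {wstar : Vec d}

theorem dependsOn_noise : DependsOn (A.noise t k) (A.batch t k : Set (ℕ × ℕ × ℕ))ᶜ :=
  fun _ _ hab => by
    unfold noise z x y
    rw [dependsOn_state hab, dependsOn_w_compl_batch hab]

theorem gradError_eq_smul_sum_noise (hm : A.m (t + 1) (k + 1) ≠ 0) :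
    A.gradError t k a =
      (1 / (A.m (t + 1) (k + 1) : ℝ)) • ∑ s ∈ A.batch t k, A.noise t k a (a s) := by
  have hm' : (A.m (t + 1) (k + 1) : ℝ) ≠ 0 := Nat.cast_ne_zero.2 hm
  simp only [noise, Finset.sum_sub_distrib, Finset.sum_const, card_batch]
  rw [smul_sub, ← Nat.cast_smul_eq_nsmul ℝ, smul_smul, one_div_mul_cancel hm', one_smul]
  simp only [gradError, gradEstimate, batchGrad, batch, Finset.sum_product, Finset.sum_singleton]

variable [NeZero n] {Ω : Type*} [Fintype Ω] {X : Ω → ℕ × ℕ × ℕ → Fin n} {J : Finset (ℕ × ℕ × ℕ)}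

theorem IsAdmissible.expect_noise (h : A.IsAdmissible K wstar) : 𝔼 i, A.noise t k a i = 0 :=
  expect_vrGrad_sub (fun i => (h.convexSmooth i).differentiable) _ _

theorem IsAdmissible.expect_inner_gradError_eq_zero (h : A.IsAdmissible K wstar)
    (hX : IsResampleInvariant X J) (hB : A.batch t k ⊆ J) (hm : A.m (t + 1) (k + 1) ≠ 0) :
    𝔼 ω, inner ℝ (A.gradError t k (X ω)) (A.x t k (X ω) - wstar) = 0 := by
  simp only [gradError_eq_smul_sum_noise _ hm, real_inner_smul_left]
  rw [← Finset.mul_expect, hX.expect_inner_sum_eq_zero hB dependsOn_noise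
    (c := fun a => A.x t k a - wstar) _ fun a => h.expect_noise a, mul_zero]
  intro a b hab
  simp only [x, dependsOn_state hab]

theorem IsAdmissible.mul_expect_norm_gradError_sq (h : A.IsAdmissible K wstar)
    (hX : IsResampleInvariant X J) (hB : A.batch t k ⊆ J) (hm : A.m (t + 1) (k + 1) ≠ 0) :
    A.m (t + 1) (k + 1) * 𝔼 ω, ‖A.gradError t k (X ω)‖ ^ 2 =
      𝔼 ω, 𝔼 i, ‖A.noise t k (X ω) i‖ ^ 2 := by
  have hm' : (A.m (t + 1) (k + 1) : ℝ) ≠ 0 := Nat.cast_ne_zero.2 hm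
  simp only [gradError_eq_smul_sum_noise _ hm, norm_smul, mul_pow, Real.norm_eq_abs, sq_abs]
  rw [← Finset.mul_expect, hX.expect_norm_sum_sq hB dependsOn_noise fun a => h.expect_noise a,
    card_batch]
  field_simp

theorem IsAdmissible.mul_expect_norm_gradError_sq_le (h : A.IsAdmissible K wstar)
    (hX : IsResampleInvariant X J) (hB : A.batch t k ⊆ J) (hm : A.m (t + 1) (k + 1) ≠ 0)
    (hk : k ≤ A.N (t + 1)) :
    A.m (t + 1) (k + 1) * 𝔼 ω, ‖A.gradError t k (X ω)‖ ^ 2 ≤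
      3 * (A.L ^ 2 * ((2 / (k + 2 : ℝ)) ^ 2 * (2 * 𝔼 ω, ‖A.x t k (X ω) - wstar‖ ^ 2 +
          2 * 𝔼 ω, ‖A.y t k (X ω) - wstar‖ ^ 2)) +
        2 * A.L * 𝔼 ω, optGap A.F wstar (A.y t k (X ω)) +
        2 * A.L * 𝔼 ω, optGap A.F wstar (A.w t (X ω))) := by
  rw [h.mul_expect_norm_gradError_sq hX hB hm]
  simp only [Finset.mul_expect, ← Finset.expect_add_distrib]
  refine Finset.expect_le_expect fun ω _ => ?_
  refine (h.expect_norm_vrGrad_sub_sq_le (h.y_mem (a := X ω) hk) h.w_mem _).trans ?_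
  gcongr
  exact norm_z_sub_y_sq_le wstar

end GradientError

end Run

section Recursion

variable {L R : ℝ}

theorem scaled_variance_le {k N : ℕ} (hL : 0 < L) (hN : 1 ≤ N) (hk : k < N) {g₀ g b c v : ℝ}
    (hg₀ : 0 ≤ g₀) (hg : 0 ≤ g) (hb : 0 ≤ b) (hR : 0 ≤ R) (hstart : k = 0 → g = g₀)
    (hinit : (N + 1) ^ 2 * g₀ ≤ 30 * L * R) (hpot : k * (k + 1) * g + 3 * L * b ≤ 8 * L * R)
    (hc : c ≤ 8 / 3 * R)
    (hv : 700 * N * v ≤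
      3 * (L ^ 2 * ((2 / (k + 2 : ℝ)) ^ 2 * (2 * b + 2 * c)) + 2 * L * g + 2 * L * g₀)) :
    (k + 1) ^ 2 / L * v ≤ L * R / N := by
  have hN' : (0 : ℝ) < N := by exact_mod_cast hN
  have hkN : (k + 1 : ℝ) ≤ N + 1 := by exact_mod_cast Nat.succ_le_succ hk.le
  have hLR : 0 ≤ L * R := mul_nonneg hL.le hR
  have hsnap : (k + 1) ^ 2 * g₀ ≤ 30 * (L * R) := by
    have := mul_le_mul_of_nonneg_right (pow_le_pow_left₀ (by positivity) hkN 2) hg₀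
    linarith
  have hcur : (k + 1) ^ 2 * g ≤ 30 * (L * R) := by
    rcases Nat.eq_zero_or_pos k with hk0 | hkpos
    · rwa [hstart hk0]
    · have hk1 : (1 : ℝ) ≤ k := by exact_mod_cast hkpos
      have hweight : (k + 1 : ℝ) ^ 2 ≤ 2 * (k * (k + 1)) := by nlinarith
      have := mul_le_mul_of_nonneg_right hweight hg
      linarith [mul_nonneg hL.le hb]
  have hdist : (k + 1) ^ 2 * ((2 / (k + 2 : ℝ)) ^ 2 * (2 * b + 2 * c)) ≤ 128 / 3 * R := by
    have hbR : b ≤ 8 / 3 * R := by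
      refine le_of_mul_le_mul_left ?_ hL
      linarith [mul_nonneg (by positivity : 0 ≤ (k * (k + 1) : ℝ)) hg]
    have hcoef : (k + 1 : ℝ) ^ 2 * (2 / (k + 2)) ^ 2 ≤ 4 := by
      rw [← mul_pow, mul_div_assoc', show (4 : ℝ) = 2 ^ 2 by norm_num]
      refine pow_le_pow_left₀ (by positivity) ?_ 2
      rw [div_le_iff₀ (by positivity)]
      linarith
    rw [← mul_assoc]
    calc _ ≤ (k + 1 : ℝ) ^ 2 * (2 / (k + 2)) ^ 2 * (32 / 3 * R) :=
          mul_le_mul_of_nonneg_left (by linarith) (by positivity)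
      _ ≤ 4 * (32 / 3 * R) := mul_le_mul_of_nonneg_right hcoef (by positivity)
      _ = 128 / 3 * R := by ring
  have hscaled := mul_le_mul_of_nonneg_left hv (sq_nonneg (k + 1 : ℝ))
  have hdistL := mul_le_mul_of_nonneg_left hdist (sq_nonneg L)
  have hcurL := mul_le_mul_of_nonneg_left hcur hL.le
  have hsnapL := mul_le_mul_of_nonneg_left hsnap hL.le
  rw [div_mul_eq_mul_div, div_le_div_iff₀ hL hN']
  linarith [mul_nonneg hL.le hLR]

theorem potential_recursion {N : ℕ} (hL : 0 < L) (hN : 1 ≤ N) {g b c v : ℕ → ℝ}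
    (hg : ∀ k ≤ N, 0 ≤ g k) (hb : ∀ k, 0 ≤ b k) (hb₀ : b 0 ≤ R) (hc₀ : c 0 ≤ R)
    (hinit : (N + 1) ^ 2 * g 0 ≤ 30 * L * R)
    (hstep : ∀ k : ℕ, k < N → (k + 1) * (k + 2) * g (k + 1) + 3 * L * b (k + 1) ≤
      k * (k + 1) * g k + 3 * L * b k + 4 * (L * R / N) + (k + 1) ^ 2 / L * v k)
    (hmix : ∀ k : ℕ, c (k + 1) ≤ (1 - 2 / (k + 2 : ℝ)) * c k + 2 / (k + 2 : ℝ) * b (k + 1))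
    (hv : ∀ k : ℕ, k < N → 700 * N * v k ≤
      3 * (L ^ 2 * ((2 / (k + 2 : ℝ)) ^ 2 * (2 * b k + 2 * c k)) + 2 * L * g k + 2 * L * g 0)) :
    N * (N + 1) * g N ≤ 8 * L * R := by
  have : (0 : ℝ) < N := by exact_mod_cast hN
  have hR : 0 ≤ R := (hb 0).trans hb₀
  set ε := L * R / N with hε
  have : 0 ≤ ε := by positivity
  have hεN : N * ε = L * R := by rw [hε]; field_simp
  have hle : ∀ k : ℕ, k ≤ N → 5 * (k * ε) ≤ 5 * (L * R) := fun k hk => by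
    rw [← hεN]
    gcongr
  have hbR : ∀ k : ℕ, k ≤ N → k * (k + 1) * g k + 3 * L * b k ≤ 3 * (L * R) + 5 * (k * ε) →
      b k ≤ 8 / 3 * R := fun k hk hpot => by
    refine le_of_mul_le_mul_left ?_ hL
    linarith [hle k hk, mul_nonneg (by positivity : 0 ≤ (k * (k + 1) : ℝ)) (hg k hk)]
  have invariant : ∀ k : ℕ, k ≤ N →
      k * (k + 1) * g k + 3 * L * b k ≤ 3 * (L * R) + 5 * (k * ε) ∧ c k ≤ 8 / 3 * R := by
    intro k
    induction k with
    | zero =>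
      refine fun _ => ⟨?_, by linarith⟩
      have := mul_le_mul_of_nonneg_left hb₀ hL.le
      push_cast
      linarith
    | succ k ih =>
      intro hk
      obtain ⟨hpot, hc⟩ := ih (by omega)
      have hnoise : (k + 1) ^ 2 / L * v k ≤ ε :=
        scaled_variance_le hL hN hk (hg 0 (by omega)) (hg k (by omega)) (hb k) hR
          (fun h => by rw [h]) hinit (by linarith [hle k (by omega)]) hc (hv k hk)
      have hpot' : ((k + 1 : ℕ) : ℝ) * ((k + 1 : ℕ) + 1) * g (k + 1) + 3 * L * b (k + 1) ≤
          3 * (L * R) + 5 * ((k + 1 : ℕ) * ε) := by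
        push_cast
        linarith [hstep k hk]
      have hγ := two_div_add_two_mem_Icc k
      have hmixc := mul_le_mul_of_nonneg_left hc (sub_nonneg.2 hγ.2)
      have hmixb := mul_le_mul_of_nonneg_left (hbR (k + 1) hk hpot') hγ.1
      exact ⟨hpot', by linarith [hmix k]⟩
  linarith [(invariant N le_rfl).1, hle N le_rfl, mul_nonneg hL.le (hb N)]

end Recursion

section Schedule

/-- The schedule of cases (a) and (b), whose epochs grow geometrically, with any batches that are at
least as large as the analysis requires. -/
def IsExponentialSchedule (D : ℝ) (Dt : ℕ → ℝ) (N : ℕ → ℕ) (m : ℕ → ℕ → ℕ) : Prop :=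
  ∀ t : ℕ, 1 ≤ t → Dt t = D ∧ N t = ⌈(2 : ℝ) ^ ((t : ℝ) / 2 + 2)⌉₊ ∧
    ∀ k : ℕ, 1 ≤ k → 700 * (N t : ℝ) ≤ m t k

/-- The schedule of case (c) for the condition number `μ`, with epochs of constant length and any
batches that are at least as large as the analysis requires. -/
def IsConstantSchedule (μ D : ℝ) (Dt : ℕ → ℝ) (N : ℕ → ℕ) (m : ℕ → ℕ → ℕ) : Prop :=
  ∀ t : ℕ, 1 ≤ t → Dt t ^ 2 = μ * D ^ 2 / (2 : ℝ) ^ (t - 1) ∧ N t = ⌈√(32 * μ)⌉₊ ∧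
    ∀ k : ℕ, 1 ≤ k → 700 * (N t * μ) ≤ m t k

/-- The numerical conditions under which every epoch halves the expected optimality gap on a set of
diameter `D`; the epochs are counted from `1` in `Dt`, `N` and `m`. -/
structure IsHalvingSchedule (D : ℝ) (Dt : ℕ → ℝ) (N : ℕ → ℕ) (m : ℕ → ℕ → ℕ) : Prop where
  one_le : ∀ t, 1 ≤ t → 1 ≤ N t
  batch_le : ∀ t, 1 ≤ t → ∀ k, 1 ≤ k → 700 * (N t : ℝ) ≤ m t k
  upper : ∀ t, 1 ≤ t → (N t + 1 : ℝ) ^ 2 * D ^ 2 ≤ 30 * 2 ^ t * Dt t ^ 2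
  lower : ∀ t, 1 ≤ t → 16 * 2 ^ t * Dt t ^ 2 ≤ N t * (N t + 1) * D ^ 2

variable {D L G μ : ℝ} {Dt : ℕ → ℝ} {N : ℕ → ℕ} {m : ℕ → ℕ → ℕ}

theorem isExponentialSchedule_of_eq_mul
    (h : ∀ t : ℕ, 1 ≤ t → Dt t = D ∧ N t = ⌈(2 : ℝ) ^ ((t : ℝ) / 2 + 2)⌉₊ ∧
      ∀ k : ℕ, 1 ≤ k → m t k = 900 * N t) : IsExponentialSchedule D Dt N m := by
  refine fun t ht => (h t ht).imp_right (And.imp_right fun hm k hk => ?_)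
  rw [hm k hk]
  push_cast
  gcongr
  norm_num

theorem isExponentialSchedule_of_eq_ceil (hL : 0 ≤ L) (hD : 0 ≤ D) (hG : 0 ≤ G)
    (h : ∀ t : ℕ, 1 ≤ t → Dt t = D ∧ N t = ⌈(2 : ℝ) ^ ((t : ℝ) / 2 + 2)⌉₊ ∧
      ∀ k : ℕ, 1 ≤ k →
        m t k = ⌈700 * (N t : ℝ) + 24 * (N t : ℝ) * G * ((k : ℝ) + 1) / (L * D)⌉₊) :
    IsExponentialSchedule D Dt N m := by
  refine fun t ht => (h t ht).imp_right (And.imp_right fun hm k hk => ?_)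
  rw [hm k hk]
  exact (le_add_of_nonneg_right (by positivity)).trans (Nat.le_ceil _)

theorem isConstantSchedule_of_eq_ceil (hμ : 0 ≤ μ)
    (h : ∀ t : ℕ, 1 ≤ t → Dt t ^ 2 = μ * D ^ 2 / (2 : ℝ) ^ (t - 1) ∧ N t = ⌈√(32 * μ)⌉₊ ∧
      ∀ k : ℕ, 1 ≤ k → m t k = ⌈5600 * (N t : ℝ) * μ⌉₊) : IsConstantSchedule μ D Dt N m := by
  refine fun t ht => (h t ht).imp_right (And.imp_right fun hm k hk => ?_)
  rw [hm k hk]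
  refine le_trans ?_ (Nat.le_ceil _)
  rw [← mul_assoc]
  gcongr
  norm_num

-- Epoch lengths are `⌈r⌉₊` with `r ≥ √32 > 5.6`.
theorem ceil_bounds {r : ℝ} (hr : 5.6 ≤ r) :
    1 ≤ ⌈r⌉₊ ∧ (⌈r⌉₊ + 1 : ℝ) ^ 2 ≤ 15 / 8 * r ^ 2 ∧ r ^ 2 ≤ ⌈r⌉₊ * (⌈r⌉₊ + 1) := by
  have hr₀ : 0 < r := by linarith
  have hle := Nat.le_ceil r
  have hlt := (Nat.ceil_lt_add_one hr₀.le).le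
  refine ⟨Nat.one_le_ceil_iff.2 hr₀, ?_, ?_⟩
  · calc (⌈r⌉₊ + 1 : ℝ) ^ 2 ≤ (r + 2) ^ 2 := pow_le_pow_left₀ (by positivity) (by linarith) 2
      _ ≤ 15 / 8 * r ^ 2 := by nlinarith
  · rw [sq]
    exact mul_le_mul hle (by linarith) hr₀.le (by positivity)

theorem IsExponentialSchedule.isHalvingSchedule (h : IsExponentialSchedule D Dt N m) :
    IsHalvingSchedule D Dt N m := by
  have bounds : ∀ t, 1 ≤ t → 1 ≤ N t ∧ (N t + 1 : ℝ) ^ 2 ≤ 30 * 2 ^ t ∧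
      16 * 2 ^ t ≤ (N t : ℝ) * (N t + 1) := fun t ht => by
    set r := (2 : ℝ) ^ ((t : ℝ) / 2 + 2) with hr
    have hr₀ : 0 < r := by positivity
    have hsq : r ^ 2 = 16 * 2 ^ t := by
      rw [hr, ← Real.rpow_natCast, ← Real.rpow_mul zero_le_two, ← Real.rpow_natCast 2 t,
        show ((t : ℝ) / 2 + 2) * (2 : ℕ) = 4 + t by push_cast; ring, Real.rpow_add two_pos]
      norm_num
    have hpow : (2 : ℝ) ≤ 2 ^ t := le_self_pow₀ one_le_two (by omega)
    have hle : 5.6 ≤ r := by nlinarith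
    obtain ⟨h1, h2, h3⟩ := ceil_bounds hle
    rw [(h t ht).2.1]
    exact ⟨h1, by linarith, by linarith⟩
  refine ⟨fun t ht => (bounds t ht).1, fun t ht => (h t ht).2.2, fun t ht => ?_, fun t ht => ?_⟩
  · rw [(h t ht).1]
    exact mul_le_mul_of_nonneg_right (bounds t ht).2.1 (sq_nonneg D)
  · rw [(h t ht).1]
    exact mul_le_mul_of_nonneg_right (bounds t ht).2.2 (sq_nonneg D)

theorem IsConstantSchedule.isHalvingSchedule (hμ : 1 ≤ μ) (h : IsConstantSchedule μ D Dt N m) :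
    IsHalvingSchedule D Dt N m := by
  have hsq : √(32 * μ) ^ 2 = 32 * μ := Real.sq_sqrt (by positivity)
  have hle : 5.6 ≤ √(32 * μ) := Real.le_sqrt_of_sq_le (by norm_num; linarith)
  obtain ⟨h1, h2, h3⟩ := ceil_bounds hle
  rw [hsq] at h2 h3
  have hDt : ∀ t, 1 ≤ t → 2 ^ t * Dt t ^ 2 = 2 * μ * D ^ 2 := fun t ht => by
    obtain ⟨s, rfl⟩ : ∃ s, t = s + 1 := ⟨t - 1, by omega⟩
    rw [(h _ ht).1, Nat.add_sub_cancel, pow_succ]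
    field_simp
  refine ⟨fun t ht => ?_, fun t ht k hk => ?_, fun t ht => ?_, fun t ht => ?_⟩
  · rwa [(h t ht).2.1]
  · linarith [(h t ht).2.2 k hk, le_mul_of_one_le_right (N t).cast_nonneg hμ]
  · rw [(h t ht).2.1]
    linarith [hDt t ht, mul_le_mul_of_nonneg_right h2 (sq_nonneg D)]
  · rw [(h t ht).2.1]
    linarith [hDt t ht, mul_le_mul_of_nonneg_right h3 (sq_nonneg D)]

end Schedule

section Convergence

variable {d n : ℕ} [NeZero n] {A : Run d n} {K : Set (Vec d)} {wstar : Vec d} {D : ℝ} {t : ℕ}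
  {Ω : Type*} [Fintype Ω] [Nonempty Ω] {X : Ω → ℕ × ℕ × ℕ → Fin n} {J : Finset (ℕ × ℕ × ℕ)}

theorem Run.IsAdmissible.expect_potential_step (h : A.IsAdmissible K wstar)
    (hX : IsResampleInvariant X J) {k : ℕ} (hB : A.batch t k ⊆ J) (hm : A.m (t + 1) (k + 1) ≠ 0)
    (hk : k < A.N (t + 1)) :
    (k + 1) * (k + 2) * 𝔼 ω, optGap A.F wstar (A.y t (k + 1) (X ω)) +
        3 * A.L * 𝔼 ω, ‖A.x t (k + 1) (X ω) - wstar‖ ^ 2 ≤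
      k * (k + 1) * 𝔼 ω, optGap A.F wstar (A.y t k (X ω)) +
        3 * A.L * 𝔼 ω, ‖A.x t k (X ω) - wstar‖ ^ 2 +
        4 * (A.L * A.Dt (t + 1) ^ 2 / A.N (t + 1)) +
        (k + 1) ^ 2 / A.L * 𝔼 ω, ‖A.gradError t k (X ω)‖ ^ 2 := by
  have hmean := Finset.expect_le_expect (s := Finset.univ) fun ω _ =>
    h.potential_step (a := X ω) hk
  simp only [Finset.expect_add_distrib, Finset.expect_sub_distrib, ← Finset.mul_expect,
    Fintype.expect_const] at hmean
  rwa [h.expect_inner_gradError_eq_zero hX hB hm, mul_zero, sub_zero] at hmean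

theorem Run.IsAdmissible.mul_expect_optGap_w_succ_le (h : A.IsAdmissible K wstar)
    (hX : IsResampleInvariant X J) (hJ : ∀ k < A.N (t + 1), A.batch t k ⊆ J)
    (hN : 1 ≤ A.N (t + 1)) (hm : ∀ k, 1 ≤ k → 700 * (A.N (t + 1) : ℝ) ≤ A.m (t + 1) k)
    (hdist : 𝔼 ω, ‖A.w t (X ω) - wstar‖ ^ 2 ≤ A.Dt (t + 1) ^ 2)
    (hgap : (A.N (t + 1) + 1) ^ 2 * 𝔼 ω, optGap A.F wstar (A.w t (X ω)) ≤
      30 * A.L * A.Dt (t + 1) ^ 2) :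
    A.N (t + 1) * (A.N (t + 1) + 1) * 𝔼 ω, optGap A.F wstar (A.w (t + 1) (X ω)) ≤
      8 * A.L * A.Dt (t + 1) ^ 2 := by
  have hbatch : ∀ k, A.m (t + 1) (k + 1) ≠ 0 := fun k => by
    have : 700 * A.N (t + 1) ≤ A.m (t + 1) (k + 1) := by exact_mod_cast hm (k + 1) (by omega)
    omega
  refine potential_recursion (g := fun k => 𝔼 ω, optGap A.F wstar (A.y t k (X ω)))
    (b := fun k => 𝔼 ω, ‖A.x t k (X ω) - wstar‖ ^ 2)
    (c := fun k => 𝔼 ω, ‖A.y t k (X ω) - wstar‖ ^ 2)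
    (v := fun k => 𝔼 ω, ‖A.gradError t k (X ω)‖ ^ 2) h.pos hN
    (fun k hk => Finset.expect_nonneg fun ω _ => h.optGap_nonneg (h.y_mem hk))
    (fun k => Finset.expect_nonneg fun ω _ => sq_nonneg _) hdist hdist hgap
    (fun k hk => ?_) (fun k => ?_) (fun k hk => ?_)
  · exact_mod_cast h.expect_potential_step hX (hJ k hk) (hbatch k) hk
  · simp only [Finset.mul_expect, ← Finset.expect_add_distrib]
    exact Finset.expect_le_expect fun ω _ => A.norm_y_succ_sub_sq_le wstar
  · refine le_trans ?_ (h.mul_expect_norm_gradError_sq_le hX (hJ k hk) (hbatch k) hk.le)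
    exact mul_le_mul_of_nonneg_right (hm (k + 1) (by omega))
      (Finset.expect_nonneg fun ω _ => sq_nonneg _)

theorem Run.IsAdmissible.expect_optGap_w_le (h : A.IsAdmissible K wstar)
    (hA : IsHalvingSchedule D A.Dt A.N A.m)
    (hstart : optGap A.F wstar A.w₀ ≤ A.L * D ^ 2 / 2) (hX : IsResampleInvariant X J)
    (hJ : A.history t 0 ⊆ J)
    (hdist : ∀ t, 𝔼 ω, optGap A.F wstar (A.w t (X ω)) ≤ A.L * D ^ 2 / 2 ^ (t + 1) →
      𝔼 ω, ‖A.w t (X ω) - wstar‖ ^ 2 ≤ A.Dt (t + 1) ^ 2) :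
    𝔼 ω, optGap A.F wstar (A.w t (X ω)) ≤ A.L * D ^ 2 / 2 ^ (t + 1) := by
  induction t with
  | zero => simpa [Run.w, iterate] using hstart
  | succ t ih =>
    have hhist : A.history t 0 ⊆ A.history (t + 1) 0 := by
      rw [Run.history_succ_zero]
      exact Run.history_zero_subset
    have hgap := ih (hhist.trans hJ)
    have ht : 1 ≤ t + 1 := Nat.le_add_left 1 t
    have hL : 0 < A.L := h.pos
    have hN : (0 : ℝ) < A.N (t + 1) := by exact_mod_cast hA.one_le _ ht
    have hwarm : (A.N (t + 1) + 1) ^ 2 * 𝔼 ω, optGap A.F wstar (A.w t (X ω)) ≤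
        30 * A.L * A.Dt (t + 1) ^ 2 := by
      refine (mul_le_mul_of_nonneg_left hgap (by positivity)).trans ?_
      rw [mul_div_assoc', div_le_iff₀ (by positivity)]
      linarith [mul_le_mul_of_nonneg_left (hA.upper _ ht) hL.le]
    have hepoch := h.mul_expect_optGap_w_succ_le hX
      (fun k hk => (A.batch_subset_history (Nat.lt_succ_self t) hk).trans hJ)
      (hA.one_le _ ht) (hA.batch_le _ ht) (hdist t hgap) hwarm
    refine le_of_mul_le_mul_left (hepoch.trans ?_) (by positivity : 0 < (A.N (t + 1) : ℝ) *
      (A.N (t + 1) + 1))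
    rw [mul_div_assoc', le_div_iff₀ (by positivity), pow_succ (2 : ℝ) (t + 1)]
    linarith [mul_le_mul_of_nonneg_left (hA.lower _ ht) hL.le]

theorem Run.IsAdmissible.expect_optGap_w_le_of_isExponentialSchedule (h : A.IsAdmissible K wstar)
    (hD : ∀ u ∈ K, ‖u - wstar‖ ≤ D)
    (hA : IsExponentialSchedule D A.Dt A.N A.m)
    (hstart : optGap A.F wstar A.w₀ ≤ A.L * D ^ 2 / 2) (hX : IsResampleInvariant X J)
    (hJ : A.history t 0 ⊆ J) :
    𝔼 ω, optGap A.F wstar (A.w t (X ω)) ≤ A.L * D ^ 2 / 2 ^ (t + 1) := by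
  refine h.expect_optGap_w_le hA.isHalvingSchedule hstart hX hJ fun t _ => ?_
  rw [(hA (t + 1) (by omega)).1]
  exact Finset.expect_le Finset.univ_nonempty fun ω _ =>
    pow_le_pow_left₀ (norm_nonneg _) (hD _ h.w_mem) 2

theorem Run.IsAdmissible.expect_optGap_w_le_of_isStronglyConvex (h : A.IsAdmissible K wstar)
    {α : ℝ} (hα : 0 < α) (hsc : IsStronglyConvex K α (objective A.F))
    (hA : IsConstantSchedule (A.L / α) D A.Dt A.N A.m)
    (hstart : optGap A.F wstar A.w₀ ≤ A.L * D ^ 2 / 2) (hX : IsResampleInvariant X J)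
    (hJ : A.history t 0 ⊆ J) :
    𝔼 ω, optGap A.F wstar (A.w t (X ω)) ≤ A.L * D ^ 2 / 2 ^ (t + 1) := by
  have hL : 0 < A.L := h.pos
  have hf := isConvexSmooth_objective h.convexSmooth
  rcases K.subsingleton_or_nontrivial with hK | hK
  · have hconst : ∀ ω, A.w t (X ω) = wstar := fun ω => hK h.w_mem h.mem
    simp only [hconst, optGap, sub_self, Finset.expect_const_zero]
    positivity
  have hμ : 1 ≤ A.L / α := (one_le_div hα).2 (hsc.le_of_nontrivial hf hK)
  refine h.expect_optGap_w_le (hA.isHalvingSchedule hμ) hstart hX hJ fun t hgap => ?_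
  rw [(hA (t + 1) (by omega)).1, Nat.add_sub_cancel]
  calc 𝔼 ω, ‖A.w t (X ω) - wstar‖ ^ 2
      ≤ 𝔼 ω, 2 / α * optGap A.F wstar (A.w t (X ω)) := Finset.expect_le_expect fun ω _ => by
        have := hsc.norm_sub_sq_le h.convex (hf.differentiable wstar) h.isMinOn h.mem
          (h.w_mem (t := t) (a := X ω))
        rw [div_mul_eq_mul_div, le_div_iff₀ hα, optGap]
        linarith
    _ ≤ 2 / α * (A.L * D ^ 2 / 2 ^ (t + 1)) := by
        rw [← Finset.mul_expect]
        exact mul_le_mul_of_nonneg_left hgap (by positivity)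
    _ = A.L / α * D ^ 2 / 2 ^ t := by
        field_simp
        ring

theorem Run.integrable_and_integral_optGap_w_eq_expect (A : Run d n) (wstar : Vec d) (t : ℕ)
    {S : Type*} [MeasurableSpace S] {P : Measure S} [IsProbabilityMeasure P]
    {idx : ℕ → ℕ → ℕ → S → Fin n} (hidx : IsIIDUniform P idx) :
    Integrable (fun ω => optGap A.F wstar (A.w t fun s => idx s.1 s.2.1 s.2.2 ω)) P ∧
      ∫ ω, optGap A.F wstar (A.w t fun s => idx s.1 s.2.1 s.2.2 ω) ∂P =
        𝔼 a : A.history t 0 → Fin n,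
          optGap A.F wstar (A.w t (Function.updateFinset (fun _ => 0) (A.history t 0) a)) :=
  integrable_and_integral_eq_expect (fun _ => hidx.measurable _ _ _) hidx.indep
    (fun _ => hidx.uniform _ _ _) _ (Z := fun a => optGap A.F wstar (A.w t a))
    fun _ _ hab => by simp only [Run.dependsOn_w hab]

end Convergence

theorem neZero_of_isProbabilityMeasure {n : ℕ} {S : Type*} [MeasurableSpace S] (P : Measure S)
    [IsProbabilityMeasure P] (i : S → Fin n) : NeZero n := by
  obtain ⟨ω⟩ := nonempty_of_isProbabilityMeasure P
  exact NeZero.of_pos (i ω).pos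

end STORC

end

theorem theorem2_general {d n : ℕ} {K : Set (STORC.Vec d)} (hK : Convex ℝ K) {D L : ℝ}
    (hL : 0 < L) {F : Fin n → STORC.Vec d → ℝ} (hF : ∀ i, STORC.IsConvexSmooth L (F i))
    {wstar : STORC.Vec d} (hwstar : wstar ∈ K)
    (hmin : ∀ w ∈ K, STORC.objective F wstar ≤ STORC.objective F w)
    {Dt : ℕ → ℝ} {N : ℕ → ℕ} {m : ℕ → ℕ → ℕ}
    (hcase : ((∀ u ∈ K, ‖u - wstar‖ ≤ D) ∧ STORC.IsExponentialSchedule D Dt N m) ∨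
      (∃ α : ℝ, 0 < α ∧ STORC.IsStronglyConvex K α (STORC.objective F) ∧
        STORC.IsConstantSchedule (L / α) D Dt N m))
    {w₀ : STORC.Vec d} (hw₀ : w₀ ∈ K)
    (hstart : STORC.objective F w₀ - STORC.objective F wstar ≤ L * D ^ 2 / 2)
    {solver : ℕ → ℕ → STORC.Vec d → STORC.Vec d → STORC.Vec d}
    (hsolver : STORC.IsApproxSolver K (STORC.params L Dt N m) solver)
    {S : Type*} [MeasurableSpace S] {P : MeasureTheory.Measure S}
    [MeasureTheory.IsProbabilityMeasure P]
    {idx : ℕ → ℕ → ℕ → S → Fin n} (hidx : STORC.IsIIDUniform P idx) (t : ℕ) :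
    MeasureTheory.Integrable (fun ω =>
        STORC.objective F (STORC.iterate F (STORC.params L Dt N m) solver w₀
          (fun t k j => idx t k j ω) t) - STORC.objective F wstar) P ∧
      ∫ ω, (STORC.objective F (STORC.iterate F (STORC.params L Dt N m) solver w₀
          (fun t k j => idx t k j ω) t) - STORC.objective F wstar) ∂P
        ≤ L * D ^ 2 / (2 : ℝ) ^ (t + 1) := by
  have : NeZero n := STORC.neZero_of_isProbabilityMeasure P (idx 0 0 0)
  let A : STORC.Run d n := ⟨F, L, Dt, N, m, solver, w₀⟩
  have hA : A.IsAdmissible K wstar := ⟨⟨hK, hL, hF, hwstar, hmin⟩, hw₀, hsolver⟩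
  have hX := STORC.isResampleInvariant_updateFinset (fun _ => (0 : Fin n)) (A.history t 0)
  obtain ⟨hint, hexpect⟩ := A.integrable_and_integral_optGap_w_eq_expect wstar t hidx
  refine ⟨hint, hexpect.trans_le ?_⟩
  rcases hcase with ⟨hD, hschedule⟩ | ⟨α, hα, hsc, hschedule⟩
  · exact hA.expect_optGap_w_le_of_isExponentialSchedule hD hschedule hstart hX subset_rfl
  · exact hA.expect_optGap_w_le_of_isStronglyConvex hα hsc hschedule hstart hX subset_rfl

theorem theorem2 {d n : ℕ}
    -- the problem
    (K : Set (STORC.Vec d)) (hKcompact : IsCompact K) (hKconvex : Convex ℝ K)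
    (D : ℝ) (hD : D = Metric.diam K)
    (L : ℝ) (hL : 0 < L)
    (F : Fin n → STORC.Vec d → ℝ) (hF : ∀ i, STORC.IsConvexSmooth L (F i))
    (wstar : STORC.Vec d) (hwstar : wstar ∈ K)
    (hmin : ∀ w ∈ K, STORC.objective F wstar ≤ STORC.objective F w)
    -- the parameters, in one of the three cases
    (Dt : ℕ → ℝ) (N : ℕ → ℕ) (m : ℕ → ℕ → ℕ)
    (hcase :
      (gradient (STORC.objective F) wstar = 0 ∧
        ∀ t : ℕ, 1 ≤ t → Dt t = D ∧ N t = ⌈(2 : ℝ) ^ ((t : ℝ) / 2 + 2)⌉₊ ∧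
          ∀ k : ℕ, 1 ≤ k → m t k = 900 * N t) ∨
      (∃ G : ℝ, STORC.IsGLipschitz K G (STORC.objective F) ∧
        ∀ t : ℕ, 1 ≤ t → Dt t = D ∧ N t = ⌈(2 : ℝ) ^ ((t : ℝ) / 2 + 2)⌉₊ ∧
          ∀ k : ℕ, 1 ≤ k →
            m t k = ⌈700 * (N t : ℝ) + 24 * (N t : ℝ) * G * ((k : ℝ) + 1) / (L * D)⌉₊) ∨
      (∃ α μ : ℝ, 0 < α ∧ STORC.IsStronglyConvex K α (STORC.objective F) ∧ μ = L / α ∧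
        ∀ t : ℕ, 1 ≤ t →
          Dt t ^ 2 = μ * D ^ 2 / (2 : ℝ) ^ (t - 1) ∧ N t = ⌈Real.sqrt (32 * μ)⌉₊ ∧
          ∀ k : ℕ, 1 ≤ k → m t k = ⌈5600 * (N t : ℝ) * μ⌉₊))
    -- the initial point, the inner solver and the random indices
    (x₀ : STORC.Vec d) (hx₀ : x₀ ∈ K)
    (w₀ : STORC.Vec d) (hw₀ : STORC.IsLinearArgmin K (gradient (STORC.objective F) x₀) w₀)
    (solver : ℕ → ℕ → STORC.Vec d → STORC.Vec d → STORC.Vec d)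
    (hsolver : STORC.IsFrankWolfeSolver K (STORC.params L Dt N m) solver)
    {S : Type*} [MeasurableSpace S] (P : MeasureTheory.Measure S)
    [MeasureTheory.IsProbabilityMeasure P]
    (idx : ℕ → ℕ → ℕ → S → Fin n) (hidx : STORC.IsIIDUniform P idx) (t : ℕ) :
    MeasureTheory.Integrable (fun ω =>
        STORC.objective F (STORC.iterate F (STORC.params L Dt N m) solver w₀
          (fun t k j => idx t k j ω) t) - STORC.objective F wstar) P ∧
      ∫ ω, (STORC.objective F (STORC.iterate F (STORC.params L Dt N m) solver w₀
          (fun t k j => idx t k j ω) t) - STORC.objective F wstar) ∂P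
        ≤ L * D ^ 2 / (2 : ℝ) ^ (t + 1) := by
  have hdiam : ∀ u ∈ K, ‖u - wstar‖ ≤ D := fun u hu => by
    rw [hD, ← dist_eq_norm]
    exact Metric.dist_le_diam_of_mem hKcompact.isBounded hu hwstar
  have : NeZero n := STORC.neZero_of_isProbabilityMeasure P (idx 0 0 0)
  have hstart := hw₀.sub_le_diam (STORC.isConvexSmooth_objective hF) hL.le hKcompact.isBounded hx₀
    hwstar
  rw [← hD] at hstart
  refine theorem2_general hKconvex hL hF hwstar hmin ?_ hw₀.1 hstart
    (hsolver.isApproxSolver hKconvex) hidx t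
  rcases hcase with ⟨-, h⟩ | ⟨G, hG, h⟩ | ⟨α, μ, hα, hsc, rfl, h⟩
  · exact Or.inl ⟨hdiam, STORC.isExponentialSchedule_of_eq_mul h⟩
  · have hG₀ : 0 ≤ G := (norm_nonneg _).trans (hG wstar hwstar)
    have hD₀ : 0 ≤ D := hD ▸ Metric.diam_nonneg
    exact Or.inl ⟨hdiam, STORC.isExponentialSchedule_of_eq_ceil hL.le hD₀ hG₀ h⟩
  · exact Or.inr ⟨α, hα, hsc, STORC.isConstantSchedule_of_eq_ceil (div_pos hL hα).le h⟩
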